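/- Let $\lambda\neq 0$ and $R>0$ be real numbers, and let $f(m)=\sum_{k=0}^{m-1}R^k$ for integers $m\ge 0$. For an integer $n\neq 0$ let $\mathrm{ord}_2\,n$ be the exponent of $2$ in the prime factorization of $n$. Consider the discrete Schrödinger operator $$(H\psi)(n)=\psi(n-1)+\psi(n+1)+V(n)\psi(n)$$ with the hierarchical potential $V(n)=\lambda f(\mathrm{ord}_2\,n)$, $n\ne 0$, in either of the following two settings: (i) in $\ell^2(\mathbb Z)$, with an arbitrary real value $V(0)$; (ii) in $\ell^2(\{1,2,3,\dots\})$, with the Dirichlet boundary condition $\psi(0)=0$. In both cases $H$ is taken on its maximal domain $\{\psi\in\ell^2: H\psi\in\ell^2\}$. Then there is a unique strongly continuous unitary group $e^{-itH}$, $t\in\mathbb R$, with generator $-iH$. Put $\delta_1(t)=e^{-itH}\delta_1$ and, for $p>0$ and $T>0$, $$a(n,T)=\frac1T\int_0^\infty e^{-2t/T}\,|\langle\delta_n,\delta_1(t)\rangle|^2\,dt,\qquad \langle|X|^p_{\delta_1}\rangle(T)=\sum_n|n|^p\,a(n,T),$$ $$\beta^-_{\delta_1}(p)=\liminf_{T\to+\infty}\frac{\log\,\langle|X|^p_{\delta_1}\rangle(T)}{\log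 T}.$$ With $\alpha=\max\{1,\log_2R\}$ one has, for every $p>0$, $$\beta^-_{\delta_1}(p)\ \ge\ \frac{p-1-4\alpha}{1+\alpha}.$$ -/

import Mathlib

open Filter Topology MeasureTheory

noncomputable section

namespace HierModel

/-- The complex Hilbert space `ℓ²(ι)`. -/
abbrev ell2 (ι : Type) : Type := lp (fun _ : ι => ℂ) 2

/-- The unit vector `δ_n` of `ℓ²(ι)`. -/
def delta {ι : Type} [DecidableEq ι] (n : ι) : ell2 ι := lp.single 2 n (1 : ℂ)

/-- The maximal operator in `ℓ²(ι)` of a linear expression `L` acting on arbitrary functions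
`ι → ℂ`: its domain consists of all `ψ ∈ ℓ²(ι)` with `L ψ ∈ ℓ²(ι)`, and it sends `ψ` to `L ψ`. -/
def maximalOperator {ι : Type} (L : (ι → ℂ) →ₗ[ℂ] (ι → ℂ)) : ell2 ι →ₗ.[ℂ] ell2 ι where
  domain :=
    { carrier := {ψ | Memℓp (L (ψ : ι → ℂ)) 2}
      add_mem' := by
        intro a b ha hb
        simp only [Set.mem_ofPred_eq, lp.coeFn_add, map_add] at *
        exact ha.add hb
      zero_mem' := by
        simp only [Set.mem_ofPred_eq, lp.coeFn_zero, map_zero]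
        exact zero_memℓp
      smul_mem' := by
        intro c a ha
        simp only [Set.mem_ofPred_eq, lp.coeFn_smul, map_smul] at *
        exact ha.const_smul c }
  toFun :=
    { toFun := fun ψ => ⟨L ((ψ : ell2 ι) : ι → ℂ), ψ.2⟩
      map_add' := by
        intro a b
        apply lp.ext
        exact map_add L _ _
      map_smul' := by
        intro c a
        apply lp.ext
        exact map_smul L _ _ }

/-- The expression `ψ(n-1) + ψ(n+1) + V(n) ψ(n)` on the whole line `ℤ`. -/
def lineExpr (V : ℤ → ℝ) : (ℤ → ℂ) →ₗ[ℂ] (ℤ → ℂ) where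
  toFun ψ n := ψ (n - 1) + ψ (n + 1) + (V n : ℂ) * ψ n
  map_add' := by
    intro a b
    ext n
    simp only [Pi.add_apply]
    ring
  map_smul' := by
    intro c a
    ext n
    simp only [Pi.smul_apply, smul_eq_mul, RingHom.id_apply]
    ring

/-- The expression `ψ(n-1) + ψ(n+1) + V(n) ψ(n)` on the half-line `{1, 2, 3, …}`, with the
Dirichlet boundary condition `ψ(0) = 0`. -/
def halfLineExpr (V : ℕ+ → ℝ) : (ℕ+ → ℂ) →ₗ[ℂ] (ℕ+ → ℂ) where
  toFun ψ n := (if n = 1 then 0 else ψ (n - 1)) + ψ (n + 1) + (V n : ℂ) * ψ n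
  map_add' := by
    intro a b
    ext n
    simp only [Pi.add_apply]
    split_ifs <;> ring
  map_smul' := by
    intro c a
    ext n
    simp only [Pi.smul_apply, smul_eq_mul, RingHom.id_apply]
    split_ifs <;> ring

/-- The discrete Schrödinger operator with potential `V` in `ℓ²(ℤ)`, on its maximal domain. -/
def lineOperator (V : ℤ → ℝ) : ell2 ℤ →ₗ.[ℂ] ell2 ℤ := maximalOperator (lineExpr V)

/-- The discrete Schrödinger operator with potential `V` in `ℓ²({1, 2, 3, …})` with Dirichlet
boundary condition, on its maximal domain. -/
def halfLineOperator (V : ℕ+ → ℝ) : ell2 ℕ+ →ₗ.[ℂ] ell2 ℕ+ := maximalOperator (halfLineExpr V)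

/-- `U` is the strongly continuous one-parameter unitary group `U(t) = exp(-itA)`, i.e. the one
whose infinitesimal generator is exactly `-iA` (domains included). -/
structure IsUnitaryGroupOf {E : Type} [NormedAddCommGroup E] [InnerProductSpace ℂ E]
    [CompleteSpace E] (A : E →ₗ.[ℂ] E) (U : ℝ → E →L[ℂ] E) : Prop where
  unitary : ∀ t, U t ∈ unitary (E →L[ℂ] E)
  zero : U 0 = 1
  add : ∀ s t, U (s + t) = U s * U t
  continuous : ∀ ψ, Continuous fun t => U t ψ
  generator : ∀ ψ φ : E,
    (ψ, φ) ∈ A.graph ↔ HasDerivAt (fun t => U t ψ) (-(Complex.I • φ)) 0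

/-- The evolution `t ↦ exp(-itA)`: the unitary group generated by `-iA`
(an arbitrary value if there is none, i.e. if `A` is not self-adjoint). -/
def evolution {E : Type} [NormedAddCommGroup E] [InnerProductSpace ℂ E] [CompleteSpace E]
    (A : E →ₗ.[ℂ] E) : ℝ → E →L[ℂ] E :=
  Classical.epsilon (IsUnitaryGroupOf A)

/-- `a(n,T) = (1/T) ∫₀^∞ e^{-2t/T} |⟨δ_n, exp(-itA) ψ⟩|² dt`. -/
def avgProb {ι : Type} [DecidableEq ι] (A : ell2 ι →ₗ.[ℂ] ell2 ι) (ψ : ell2 ι) (n : ι) (T : ℝ) :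
    ENNReal :=
  ENNReal.ofReal (1 / T) * ∫⁻ t in Set.Ioi (0 : ℝ),
    ENNReal.ofReal (Real.exp (-2 * t / T) * ‖inner ℂ (delta n) (evolution A t ψ)‖ ^ 2)

/-- The time-averaged moment `⟨|X|_ψ^p⟩(T) = ∑_n |n|^p a(n,T)`, where `pos n` is the position of
the site with label `n`. -/
def moment {ι : Type} [DecidableEq ι] (pos : ι → ℝ) (A : ell2 ι →ₗ.[ℂ] ell2 ι) (ψ : ell2 ι)
    (p T : ℝ) : ENNReal :=
  ∑' n : ι, ENNReal.ofReal (|pos n| ^ p) * avgProb A ψ n T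

/-- The lower growth exponent `β⁻_ψ(p) = liminf_{T → ∞} log ⟨|X|_ψ^p⟩(T) / log T`, as an
extended real number. -/
def lowerExponent {ι : Type} [DecidableEq ι] (pos : ι → ℝ) (A : ell2 ι →ₗ.[ℂ] ell2 ι)
    (ψ : ell2 ι) (p : ℝ) : EReal :=
  liminf (fun T : ℝ => ENNReal.log (moment pos A ψ p T) / ((Real.log T : ℝ) : EReal)) atTop

/-- `f(m) = ∑_{k<m} R^k`. -/
def hierF (R : ℝ) (m : ℕ) : ℝ := ∑ k ∈ Finset.range m, R ^ k

/-- The hierarchical potential on `ℤ`: `V(n) = lam * f(ord₂ n)` for `n ≠ 0`. The order of `0` is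
infinite, so that the formula determines nothing there; `V(0)` is a parameter `v₀`. -/
def linePotential (lam R v₀ : ℝ) (n : ℤ) : ℝ :=
  if n = 0 then v₀ else lam * hierF R (padicValInt 2 n)

/-- The hierarchical potential `V(n) = lam * f(ord₂ n)` on `{1, 2, 3, …}`. -/
def halfLinePotential (lam R : ℝ) (n : ℕ+) : ℝ := lam * hierF R (padicValNat 2 (n : ℕ))

/-- The exponent `α(R) = max {1, log₂ R}`. -/
def hierAlpha (R : ℝ) : ℝ := max 1 (Real.logb 2 R)

end HierModel

end

/-! Only the spectral parameter `iε`, `ε = 2/T`, at distance `ε` from energy zero is needed. The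
Laplace transform `w = ∫₀^∞ e^{-εt} δ₁(t) dt` satisfies `(H - iε) w = -i δ₁`, and Cauchy–Schwarz
gives `a(n,T) ≥ (2/T²) |w(n)|²` (`exists_resolvent_le_avgProb`). So it suffices to find one distant
site where `w` is not small.

At energy zero, solutions do not decay: the potential vanishes at odd sites, so `u(2j)` merely
alternates in sign, while `u(2j+1)` changes by partial sums of the potential over even sites. For
small `z` this persists for `J` steps as long as `|z| J S` is small, `S` bounding those partial sums
(`norm_zero_le_of_recurrence`). For `J = 2^l` the self-similarity of `V` gives `S` of order `r^l`
for any `r > 2` with `r ≥ R` (`sum_even_hierF_le`). Hence at times `T` of order `(2r)^l` some site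
beyond `2^l` has `|w| ≥ 1/16`, and this site alone makes the moment at least a constant times
`2^{lp} / T²`. Letting `r` decrease to `2^α` yields every exponent below `p/(1+α) - 2`, which
exceeds the claimed one because `2α > 1`.

The unitary group is constructed directly: the multiplication group of `V` is explicit, and the
bounded hopping term is added in the interaction picture. -/

/-! ### Solutions near energy zero -/

/-- If the potential `v` vanishes at odd sites, a solution of `u(n-1) + u(n+1) + v(n) u(n) = z u(n)`
on the half-line cannot become small before `‖z‖ · J` times the size of the partial sums of the
potential becomes of order one. -/
theorem norm_zero_le_of_recurrence {u : ℕ → ℂ} {v : ℕ → ℝ} {z : ℂ} {S : ℝ} {J : ℕ}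
    (hodd : ∀ j, v (2 * j + 1) = 0)
    (hu : ∀ n, u (n + 2) + u n + (v (n + 1) : ℂ) * u (n + 1) = z * u (n + 1))
    (hS : 1 ≤ S) (hsum : ∀ j ≤ J, |∑ i ∈ Finset.range j, v (2 * i + 2)| ≤ S) (hz : ‖z‖ ≤ 1)
    (hsmall : 8 * S * ‖z‖ * J ≤ 1) :
    ‖u 0‖ ≤ 4 * (‖u (2 * J)‖ + ‖u (2 * J + 1)‖) := by
  -- For `z = 0` both `e` and `q` are constant in `j`. The weight `S` on `‖e j‖` makes `X` control
  -- `o j = q j - s j * e j`.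
  set s : ℕ → ℝ := fun j => ∑ i ∈ Finset.range j, v (2 * i + 2) with hs
  set e : ℕ → ℂ := fun j => (-1) ^ j * u (2 * j) with he
  set o : ℕ → ℂ := fun j => (-1) ^ j * u (2 * j + 1) with ho
  set q : ℕ → ℂ := fun j => o j + s j * e j with hq
  set X : ℕ → ℝ := fun j => ‖q j‖ + S * ‖e j‖ with hX
  have hen : ∀ j, ‖e j‖ = ‖u (2 * j)‖ := fun j => by simp [he]
  have hon : ∀ j, ‖o j‖ = ‖u (2 * j + 1)‖ := fun j => by simp [ho]
  have hsn : ∀ j ≤ J, ‖(s j : ℂ)‖ ≤ S := fun j hj => by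
    rw [Complex.norm_real, Real.norm_eq_abs]; exact hsum j hj
  have e_succ : ∀ j, e (j + 1) = e j - z * o j := fun j => by
    have h := hu (2 * j)
    rw [hodd j, Complex.ofReal_zero] at h
    simp only [he, ho, pow_succ, mul_add, mul_one]
    linear_combination (-(-1) ^ j) * h
  have q_succ : ∀ j, q (j + 1) = q j + z * e (j + 1) - s j * (z * o j) := fun j => by
    have h := hu (2 * j + 1)
    have hs' : s (j + 1) = s j + v (2 * j + 2) := Finset.sum_range_succ _ _
    have ho' : o (j + 1) = o j + (z - v (2 * j + 2)) * e (j + 1) := by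
      simp only [he, ho, pow_succ, mul_add, mul_one]
      linear_combination (-(-1) ^ j) * h
    have h2 : q j = o j + s j * e j := rfl
    have h3 : q (j + 1) = o (j + 1) + s (j + 1) * e (j + 1) := rfl
    rw [h3, h2, ho', hs']
    push_cast
    linear_combination (s j : ℂ) * e_succ j
  have hXe : ∀ j, ‖e j‖ ≤ X j := fun j => by
    have := mul_le_mul_of_nonneg_right hS (norm_nonneg (e j))
    have := norm_nonneg (q j)
    simp only [hX]; linarith
  have hXo : ∀ j ≤ J, ‖o j‖ ≤ X j := fun j hj => by
    have h1 : o j = q j - s j * e j := by simp [hq]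
    calc ‖o j‖ ≤ ‖q j‖ + ‖(s j : ℂ) * e j‖ := by rw [h1]; exact norm_sub_le _ _
      _ ≤ X j := by
        rw [norm_mul]
        have := mul_le_mul_of_nonneg_right (hsn j hj) (norm_nonneg (e j))
        simp only [hX]; linarith
  -- The losses are `S‖z‖X` from `e` and `2‖z‖X + S‖z‖X` from `q`; since `S ≥ 1` they add up to at
  -- most `4S‖z‖X`.
  have step : ∀ j < J, (1 - 4 * S * ‖z‖) * X j ≤ X (j + 1) := fun j hj => by
    have hzo : ‖z * o j‖ ≤ ‖z‖ * X j := by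
      rw [norm_mul]; exact mul_le_mul_of_nonneg_left (hXo j hj.le) (norm_nonneg z)
    have hX0 : 0 ≤ X j := (norm_nonneg _).trans (hXe j)
    have hzX : ‖z‖ * X j ≤ X j := mul_le_of_le_one_left hX0 hz
    have h1 : ‖e j‖ ≤ ‖e (j + 1)‖ + ‖z‖ * X j := by
      have : e j = e (j + 1) + z * o j := by rw [e_succ]; ring
      rw [this]
      exact (norm_add_le _ _).trans (by linarith)
    have h2 : ‖e (j + 1)‖ ≤ 2 * X j := by
      rw [e_succ]
      exact (norm_sub_le _ _).trans (by linarith [hXe j])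
    have h3 : ‖q j‖ ≤ ‖q (j + 1)‖ + ‖z‖ * (2 * X j) + S * (‖z‖ * X j) := by
      have : q j = q (j + 1) - z * e (j + 1) + s j * (z * o j) := by rw [q_succ]; ring
      calc ‖q j‖ = ‖q (j + 1) - z * e (j + 1) + s j * (z * o j)‖ := by rw [← this]
        _ ≤ ‖q (j + 1)‖ + ‖z * e (j + 1)‖ + ‖(s j : ℂ) * (z * o j)‖ :=
          (norm_add_le _ _).trans (by gcongr; exact norm_sub_le _ _)
        _ ≤ _ := by
          rw [norm_mul z, norm_mul (s j : ℂ)]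
          gcongr
          exact hsn j hj.le
    have h4 : ‖z‖ * X j ≤ S * (‖z‖ * X j) := le_mul_of_one_le_left (by positivity) hS
    have h5 := mul_le_mul_of_nonneg_left h1 (zero_le_one.trans hS)
    have h6 : X j = ‖q j‖ + S * ‖e j‖ := rfl
    have h7 : X (j + 1) = ‖q (j + 1)‖ + S * ‖e (j + 1)‖ := rfl
    nlinarith
  have hδ : 0 ≤ S * ‖z‖ := by positivity
  -- Bernoulli's inequality; at `j = J` the smallness assumption leaves a factor of at least `1/2`.
  have iter : ∀ j ≤ J, (1 - 4 * S * ‖z‖ * j) * X 0 ≤ X j := by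
    intro j
    induction j with
    | zero => intro _; simp
    | succ j ih =>
      intro hj
      have hX0 : 0 ≤ X 0 := (norm_nonneg _).trans (hXe 0)
      have hjJ : (j : ℝ) + 1 ≤ J := by exact_mod_cast hj
      have hj0 : (0 : ℝ) ≤ j := Nat.cast_nonneg j
      have h1 : 0 ≤ 1 - 4 * S * ‖z‖ := by nlinarith
      have h2 := mul_le_mul_of_nonneg_left (ih (by omega)) h1
      have h3 := step j hj
      have h4 : 0 ≤ (S * ‖z‖) ^ 2 * j * X 0 := by positivity
      push_cast
      nlinarith
  have h1 := iter J le_rfl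
  have h0 : S * ‖u 0‖ ≤ X 0 := by
    have : ‖e 0‖ = ‖u 0‖ := hen 0
    simp only [hX, this]
    linarith [norm_nonneg (q 0)]
  have h2 : X 0 ≤ 2 * X J := by
    have hX0 : 0 ≤ X 0 := (norm_nonneg _).trans (hXe 0)
    nlinarith
  have h3 : X J ≤ ‖o J‖ + 2 * S * ‖e J‖ := by
    have : ‖q J‖ ≤ ‖o J‖ + S * ‖e J‖ := by
      refine (norm_add_le _ _).trans ?_
      rw [norm_mul (s J : ℂ)]
      have := mul_le_mul_of_nonneg_right (hsn J le_rfl) (norm_nonneg (e J))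
      linarith
    simp only [hX]; linarith
  rw [← hen, ← hon]
  have h4 : ‖o J‖ ≤ S * ‖o J‖ := le_mul_of_one_le_left (norm_nonneg _) hS
  have h6 : 0 ≤ S * ‖o J‖ := by positivity
  have h5 : S * ‖u 0‖ ≤ S * (4 * (‖e J‖ + ‖o J‖)) := by linarith
  exact le_of_mul_le_mul_left h5 (by linarith)

/-! ### Partial sums of the hierarchical potential -/

namespace HierModel

theorem hierF_succ (R : ℝ) (m : ℕ) : hierF R (m + 1) = 1 + R * hierF R m := by
  simp only [hierF, Finset.sum_range_succ', Finset.mul_sum, pow_succ', pow_zero]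
  ring

theorem hierF_nonneg {R : ℝ} (hR : 0 < R) (m : ℕ) : 0 ≤ hierF R m :=
  Finset.sum_nonneg fun _ _ => by positivity

theorem hierF_padicValNat_odd (R : ℝ) (j : ℕ) : hierF R (padicValNat 2 (2 * j + 1)) = 0 := by
  rw [padicValNat.eq_zero_of_not_dvd (by omega)]
  simp [hierF]

theorem hierF_padicValNat_even (R : ℝ) {n : ℕ} (hn : n ≠ 0) :
    hierF R (padicValNat 2 (2 * n)) = 1 + R * hierF R (padicValNat 2 n) := by
  rw [padicValNat.mul two_ne_zero hn, padicValNat_self, add_comm, hierF_succ]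

theorem sum_range_two_mul {M : Type*} [AddCommMonoid M] (g : ℕ → M) (m : ℕ) :
    ∑ i ∈ Finset.range (2 * m), g i = ∑ i ∈ Finset.range m, (g (2 * i) + g (2 * i + 1)) := by
  induction m with
  | zero => simp
  | succ m ih =>
    rw [show 2 * (m + 1) = 2 * m + 1 + 1 by ring, Finset.sum_range_succ, Finset.sum_range_succ, ih,
      Finset.sum_range_succ, add_assoc]

/-- Halving the even sites gives `A (l+1) = 2^(l+1) + R * A l`, as odd sites contribute zero to the
second term. The bound solves this recursion exactly with `r` in place of `R`; taking `r > 2`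
strictly avoids the extra factor `l` that appears at `R = 2`. -/
theorem sum_even_hierF_le {R r : ℝ} (hR : 0 < R) (hr : 2 < r) (hRr : R ≤ r) (l : ℕ) :
    ∑ i ∈ Finset.range (2 ^ l), hierF R (padicValNat 2 (2 * i + 2)) ≤
      (r ^ (l + 1) - 2 ^ (l + 1)) / (r - 2) := by
  have hr2 : 0 < r - 2 := by linarith
  induction l with
  | zero =>
    have : hierF R 1 = 1 := by simp [hierF]
    simp [this, hr2.ne']
  | succ l ih =>
    have h1 : ∑ i ∈ Finset.range (2 ^ (l + 1)), hierF R (padicValNat 2 (2 * i + 2)) =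
        2 ^ (l + 1) +
          R * ∑ i ∈ Finset.range (2 ^ l), hierF R (padicValNat 2 (2 * i + 2)) := by
      have h2 : ∀ i : ℕ, hierF R (padicValNat 2 (2 * i + 2)) =
          1 + R * hierF R (padicValNat 2 (i + 1)) := fun i => by
        rw [show 2 * i + 2 = 2 * (i + 1) by ring, hierF_padicValNat_even R (by omega)]
      have h3 : ∑ i ∈ Finset.range (2 ^ (l + 1)), hierF R (padicValNat 2 (i + 1)) =
          ∑ i ∈ Finset.range (2 ^ l), hierF R (padicValNat 2 (2 * i + 2)) := by
        rw [pow_succ', sum_range_two_mul]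
        simp only [hierF_padicValNat_odd, zero_add]
      rw [Finset.sum_congr rfl fun i _ => h2 i, Finset.sum_add_distrib, ← Finset.mul_sum, h3]
      simp
    have h0 : 0 ≤ ∑ i ∈ Finset.range (2 ^ l), hierF R (padicValNat 2 (2 * i + 2)) :=
      Finset.sum_nonneg fun _ _ => hierF_nonneg hR _
    rw [h1]
    calc _ ≤ 2 ^ (l + 1) + r * ((r ^ (l + 1) - 2 ^ (l + 1)) / (r - 2)) := by gcongr
      _ = _ := by field_simp; ring

/-- Lower bound on solutions at scale `2 ^ l` for the hierarchical potential. -/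
theorem exists_norm_ge_of_recurrence {lam R r : ℝ} (hR : 0 < R) (hr : 2 < r) (hRr : R ≤ r)
    {u : ℕ → ℂ} {z : ℂ}
    (hu : ∀ n, u (n + 2) + u n +
      ((lam * hierF R (padicValNat 2 (n + 1)) : ℝ) : ℂ) * u (n + 1) = z * u (n + 1))
    {l : ℕ} (hz : 8 * (1 + |lam| * (r / (r - 2))) * ‖z‖ * (2 * r) ^ l ≤ 1) :
    ∃ n : ℕ, 2 ^ l ≤ n ∧ ‖u 0‖ ≤ 8 * ‖u n‖ := by
  have hr2 : 0 < r - 2 := by linarith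
  have hrl : 1 ≤ r ^ l := one_le_pow₀ (by linarith)
  set S : ℝ := (1 + |lam| * (r / (r - 2))) * r ^ l with hS
  have hK : 1 ≤ 1 + |lam| * (r / (r - 2)) := by
    have : 0 ≤ |lam| * (r / (r - 2)) := by positivity
    linarith
  have hS1 : 1 ≤ S := one_le_mul_of_one_le_of_one_le hK hrl
  have hz' : 8 * S * ‖z‖ * ((2 ^ l : ℕ) : ℝ) ≤ 1 := by
    refine le_trans (le_of_eq ?_) hz
    rw [hS, mul_pow]; push_cast; ring
  have hz1 : ‖z‖ ≤ 1 := by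
    have h2 : (1 : ℝ) ≤ ((2 ^ l : ℕ) : ℝ) := by exact_mod_cast Nat.one_le_two_pow
    have h3 : 1 ≤ S * ((2 ^ l : ℕ) : ℝ) := one_le_mul_of_one_le_of_one_le hS1 h2
    nlinarith [norm_nonneg z]
  have key := norm_zero_le_of_recurrence (u := u) (J := 2 ^ l)
    (v := fun n => lam * hierF R (padicValNat 2 n))
    (fun j => by simp [hierF_padicValNat_odd]) hu hS1 (fun j hj => by
      rw [← Finset.mul_sum, abs_mul,
        abs_of_nonneg (Finset.sum_nonneg fun _ _ => hierF_nonneg hR _)]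
      have h1 : ∑ i ∈ Finset.range j, hierF R (padicValNat 2 (2 * i + 2)) ≤
          ∑ i ∈ Finset.range (2 ^ l), hierF R (padicValNat 2 (2 * i + 2)) :=
        Finset.sum_le_sum_of_subset_of_nonneg (Finset.range_mono hj)
          fun _ _ _ => hierF_nonneg hR _
      have h2 : (r ^ (l + 1) - 2 ^ (l + 1)) / (r - 2) ≤ r / (r - 2) * r ^ l := by
        rw [div_mul_eq_mul_div, ← pow_succ']
        gcongr
        have : (0 : ℝ) < 2 ^ (l + 1) := by positivity
        linarith
      calc _ ≤ |lam| * (r / (r - 2) * r ^ l) := by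
            gcongr
            exact (h1.trans (sum_even_hierF_le hR hr hRr l)).trans h2
        _ ≤ S := by rw [hS]; linarith) hz1 hz'
  -- The larger of the two values in `key` is at least `‖u 0‖ / 8`.
  have hpos : 0 < 2 ^ l := by positivity
  by_cases h : ‖u (2 * 2 ^ l)‖ ≤ ‖u (2 * 2 ^ l + 1)‖
  · exact ⟨2 * 2 ^ l + 1, by omega, by linarith⟩
  · exact ⟨2 * 2 ^ l, by omega, by linarith⟩

end HierModel

/-! ### Linear equations with bounded, strongly continuous coefficients -/

section BoundedFamilies

variable {E : Type} [NormedAddCommGroup E] [InnerProductSpace ℂ E]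

theorem HasDerivAt.continuousLinearMap_apply {y : ℝ → E} {y' : E} {t : ℝ} (f : E →L[ℂ] E)
    (h : HasDerivAt y y' t) : HasDerivAt (fun s => f (y s)) (f y') t :=
  (f.restrictScalars ℝ).hasFDerivAt.comp_hasDerivAt t h

theorem hasDerivAt_zero_iff_tendsto_slope {y : ℝ → E} {y' : E} :
    HasDerivAt y y' 0 ↔
      Tendsto (fun t : ℝ => ((t⁻¹ : ℝ) : ℂ) • (y t - y 0)) (𝓝[≠] 0) (𝓝 y') := by
  rw [hasDerivAt_iff_tendsto_slope_zero]
  simp only [zero_add, Complex.coe_smul]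

/-- Joint continuity of a strongly convergent, bounded family of operators. -/
theorem tendsto_apply_of_norm_le {α : Type*} {l : Filter α} {K : α → E →L[ℂ] E} {C : ℝ}
    (hC : ∀ a, ‖K a‖ ≤ C) {z : α → E} {z₀ k : E} (hz : Tendsto z l (𝓝 z₀))
    (hK : Tendsto (fun a => K a z₀) l (𝓝 k)) : Tendsto (fun a => K a (z a)) l (𝓝 k) := by
  have h1 : Tendsto (fun a => K a (z a - z₀)) l (𝓝 0) := by
    refine squeeze_zero_norm (a := fun a => C * ‖z a - z₀‖) (fun a => ?_) ?_
    · exact ((K a).le_opNorm _).trans (mul_le_mul_of_nonneg_right (hC a) (norm_nonneg _))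
    · have := (tendsto_iff_norm_sub_tendsto_zero.1 hz).const_mul C
      simpa using this
  have h2 := h1.add hK
  simp only [map_sub, sub_add_cancel, zero_add] at h2
  exact h2

theorem continuous_apply_of_norm_le {K : ℝ → E →L[ℂ] E} {C : ℝ} (hC : ∀ t, ‖K t‖ ≤ C)
    (hK : ∀ ψ, Continuous fun t => K t ψ) {y : ℝ → E} (hy : Continuous y) :
    Continuous fun t => K t (y t) :=
  continuous_iff_continuousAt.2 fun t =>
    tendsto_apply_of_norm_le hC (hy.tendsto t) ((hK (y t)).tendsto t)

theorem eq_of_hasDerivAt_apply {K : ℝ → E →L[ℂ] E} {C : ℝ} (hC : ∀ t, ‖K t‖ ≤ C)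
    {y w : ℝ → E} (hy : ∀ t, HasDerivAt y (K t (y t)) t) (hw : ∀ t, HasDerivAt w (K t (w t)) t)
    (h0 : y 0 = w 0) : y = w :=
  ODE_solution_unique_univ (v := fun t x => K t x) (s := fun _ => Set.univ) (K := C.toNNReal)
    (t₀ := 0)
    (fun t => ((K t).lipschitz.weaken (by
      rw [← norm_toNNReal]; exact Real.toNNReal_le_toNNReal (hC t))).lipschitzOnWith)
    (fun t => ⟨hy t, trivial⟩) (fun t => ⟨hw t, trivial⟩) h0

theorem norm_eq_of_hasDerivAt {y y' : ℝ → E} (hy : ∀ t, HasDerivAt y (y' t) t)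
    (h : ∀ t, inner ℂ (y t) (y' t) + inner ℂ (y' t) (y t) = 0) (t : ℝ) : ‖y t‖ = ‖y 0‖ := by
  have hd : ∀ t, HasDerivAt (fun t => inner ℂ (y t) (y t)) 0 t := fun t => by
    rw [← h t]; exact (hy t).inner ℂ (hy t)
  have hc := is_const_of_deriv_eq_zero (fun t => (hd t).differentiableAt) (fun t => (hd t).deriv) t 0
  simp only [inner_self_eq_norm_sq_to_K] at hc
  have h2 : ‖y t‖ ^ 2 = ‖y 0‖ ^ 2 := by exact_mod_cast hc
  exact (sq_eq_sq₀ (norm_nonneg _) (norm_nonneg _)).1 h2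

variable [CompleteSpace E]

/-- The terms of the Dyson series of the linear equation `y' = K(t) y`, `y(0) = ψ`. -/
noncomputable def dysonTerm (K : ℝ → E →L[ℂ] E) (ψ : E) : ℕ → ℝ → E
  | 0 => fun _ => ψ
  | n + 1 => fun t => ∫ s in (0 : ℝ)..t, K s (dysonTerm K ψ n s)

theorem continuous_dysonTerm {K : ℝ → E →L[ℂ] E} {C : ℝ} (hC : ∀ t, ‖K t‖ ≤ C)
    (hK : ∀ ψ, Continuous fun t => K t ψ) (ψ : E) (n : ℕ) : Continuous (dysonTerm K ψ n) := by
  induction n with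
  | zero => exact continuous_const
  | succ n ih =>
    exact continuous_iff_continuousAt.2 fun t =>
      ((continuous_apply_of_norm_le hC hK ih).integral_hasStrictDerivAt 0 t).hasDerivAt.continuousAt

theorem norm_dysonTerm_le {K : ℝ → E →L[ℂ] E} {C : ℝ} (hC : ∀ t, ‖K t‖ ≤ C)
    (hK : ∀ ψ, Continuous fun t => K t ψ) (ψ : E) (n : ℕ) (t : ℝ) :
    ‖dysonTerm K ψ n t‖ ≤ ‖ψ‖ * (C * |t|) ^ n / n.factorial := by
  have hC0 : 0 ≤ C := (norm_nonneg _).trans (hC 0)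
  induction n generalizing t with
  | zero => simp [dysonTerm]
  | succ n ih =>
    have hcont := continuous_apply_of_norm_le hC hK (continuous_dysonTerm hC hK ψ n)
    calc ‖dysonTerm K ψ (n + 1) t‖ ≤ ∫ s in Set.uIoc 0 t, ‖K s (dysonTerm K ψ n s)‖ :=
          intervalIntegral.norm_integral_le_integral_norm_uIoc
      _ ≤ ∫ s in Set.uIoc 0 t, ‖ψ‖ * C ^ (n + 1) / n.factorial * |s - 0| ^ n := by
          refine setIntegral_mono_on ?_ ?_ measurableSet_uIoc fun s _ => ?_
          · exact (hcont.norm.integrableOn_uIcc (a := 0) (b := t)).mono_set Set.uIoc_subset_uIcc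
          · have : Continuous fun s : ℝ => ‖ψ‖ * C ^ (n + 1) / n.factorial * |s - 0| ^ n := by
              fun_prop
            exact (this.integrableOn_uIcc (a := 0) (b := t)).mono_set Set.uIoc_subset_uIcc
          · refine ((K s).le_opNorm _).trans ?_
            calc ‖K s‖ * ‖dysonTerm K ψ n s‖ ≤ C * (‖ψ‖ * (C * |s|) ^ n / n.factorial) := by
                  gcongr
                  · exact hC s
                  · exact ih s
              _ = _ := by rw [sub_zero, mul_pow]; ring
      _ = _ := by
          rw [integral_const_mul, integral_pow_abs_sub_uIoc, sub_zero, Nat.factorial_succ]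
          push_cast
          rw [mul_pow]
          field_simp

/-- Global solvability of a linear equation with bounded, strongly continuous coefficients. -/
theorem exists_hasDerivAt_apply {K : ℝ → E →L[ℂ] E} {C : ℝ} (hC : ∀ t, ‖K t‖ ≤ C)
    (hK : ∀ ψ, Continuous fun t => K t ψ) (ψ : E) :
    ∃ y : ℝ → E, y 0 = ψ ∧ ∀ t, HasDerivAt y (K t (y t)) t := by
  have hC0 : 0 ≤ C := (norm_nonneg _).trans (hC 0)
  set Y := dysonTerm K ψ with hY
  have hsum : ∀ t, Summable fun n => Y n t := fun t =>
    Summable.of_norm_bounded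
      (by simpa only [mul_div_assoc] using (Real.summable_pow_div_factorial (C * |t|)).mul_left ‖ψ‖)
      fun n => norm_dysonTerm_le hC hK ψ n t
  refine ⟨fun t => ∑' n, Y n t, ?_, fun t => ?_⟩
  · change ∑' n, Y n 0 = ψ
    rw [tsum_eq_single 0]
    · rfl
    · intro n hn
      obtain ⟨m, rfl⟩ := Nat.exists_eq_succ_of_ne_zero hn
      exact intervalIntegral.integral_same
  -- The differentiated series is dominated uniformly only on bounded intervals, so the series is
  -- differentiated termwise on `(-b, b)`, which contains `t`. The dominating series is exponential,
  -- shifted by one index.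
  · set b : ℝ := |t| + 1 with hb
    have hb0 : 0 ≤ b := by positivity
    let Y' : ℕ → ℝ → E := fun n s => match n with
      | 0 => 0
      | n + 1 => K s (Y n s)
    let B : ℕ → ℝ := fun n => match n with
      | 0 => 0
      | n + 1 => C * (‖ψ‖ * ((C * b) ^ n / n.factorial))
    have hB : Summable B := by
      rw [← summable_nat_add_iff 1]
      exact ((Real.summable_pow_div_factorial (C * b)).mul_left ‖ψ‖).mul_left C
    have hder : ∀ n s, s ∈ Set.Ioo (-b) b → HasDerivAt (Y n) (Y' n s) s := by
      intro n s _
      cases n with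
      | zero => exact hasDerivAt_const s ψ
      | succ n =>
        exact ((continuous_apply_of_norm_le hC hK
          (continuous_dysonTerm hC hK ψ n)).integral_hasStrictDerivAt 0 s).hasDerivAt
    have hbd : ∀ n s, s ∈ Set.Ioo (-b) b → ‖Y' n s‖ ≤ B n := by
      intro n s hs
      cases n with
      | zero => simp [Y', B]
      | succ n =>
        refine ((K s).le_opNorm _).trans ?_
        refine mul_le_mul (hC s) ((norm_dysonTerm_le hC hK ψ n s).trans ?_) (norm_nonneg _) hC0
        rw [mul_div_assoc]
        gcongr
        exact (abs_lt.2 hs).le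
    have ht : t ∈ Set.Ioo (-b) b := abs_lt.1 (by rw [hb]; linarith)
    have key := hasDerivAt_tsum_of_isPreconnected hB isOpen_Ioo isPreconnected_Ioo hder hbd ht
      (hsum t) ht
    convert key using 1
    have hs' : Summable fun n => Y' n t := Summable.of_norm_bounded hB fun n => hbd n t ht
    rw [hs'.tsum_eq_zero_add, (K t).map_tsum (hsum t)]
    simp [Y']

/-- An isometry has its adjoint as left inverse; a right inverse must then coincide with the
adjoint. -/
theorem mem_unitary_of_norm_map {u v : E →L[ℂ] E} (hu : ∀ x, ‖u x‖ = ‖x‖) (huv : u * v = 1) :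
    u ∈ unitary (E →L[ℂ] E) := by
  have h1 : star u * u = 1 := u.norm_map_iff_adjoint_comp_self.1 hu
  have h2 : star u = v := left_inv_eq_right_inv h1 huv
  exact Unitary.mem_iff.2 ⟨h1, by rw [h2, huv]⟩

end BoundedFamilies

/-! ### Unitary groups: uniqueness and bounded perturbations -/

namespace HierModel

namespace IsUnitaryGroupOf

variable {E : Type} [NormedAddCommGroup E] [InnerProductSpace ℂ E] [CompleteSpace E]
  {A : E →ₗ.[ℂ] E} {U : ℝ → E →L[ℂ] E}

theorem norm_apply (h : IsUnitaryGroupOf A U) (t : ℝ) (ψ : E) : ‖U t ψ‖ = ‖ψ‖ :=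
  ContinuousLinearMap.norm_map_of_mem_unitary (h.unitary t) ψ

theorem norm_le_one (h : IsUnitaryGroupOf A U) (t : ℝ) : ‖U t‖ ≤ 1 :=
  (U t).opNorm_le_bound zero_le_one fun ψ => by rw [h.norm_apply, one_mul]

theorem add_apply (h : IsUnitaryGroupOf A U) (s t : ℝ) (ψ : E) : U (s + t) ψ = U s (U t ψ) := by
  rw [h.add]; rfl

theorem zero_apply (h : IsUnitaryGroupOf A U) (ψ : E) : U 0 ψ = ψ := by
  rw [h.zero]; rfl

theorem apply_neg_apply (h : IsUnitaryGroupOf A U) (t : ℝ) (ψ : E) : U t (U (-t) ψ) = ψ := by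
  rw [← h.add_apply, add_neg_cancel, h.zero_apply]

theorem inner_apply (h : IsUnitaryGroupOf A U) (t : ℝ) (ψ φ : E) :
    inner ℂ (U t ψ) (U t φ) = inner ℂ ψ φ :=
  (LinearMap.norm_map_iff_inner_map_map (𝕜 := ℂ) (U t)).1 (h.norm_apply t) ψ φ

theorem inner_neg_apply (h : IsUnitaryGroupOf A U) (t : ℝ) (ψ φ : E) :
    inner ℂ (U (-t) ψ) φ = inner ℂ ψ (U t φ) := by
  rw [← h.inner_apply t, h.apply_neg_apply]

theorem hasDerivAt (h : IsUnitaryGroupOf A U) {ψ φ : E} (hψ : (ψ, φ) ∈ A.graph) (t : ℝ) :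
    HasDerivAt (fun s => U s ψ) (-(Complex.I • U t φ)) t := by
  have h1 := ((h.generator ψ φ).1 hψ).continuousLinearMap_apply (U t)
  have h2 : HasDerivAt (fun s => U t (U (-t + s) ψ)) (U t (-(Complex.I • φ))) t :=
    HasDerivAt.comp_const_add (-t) t (f := fun s => U t (U s ψ)) (by rwa [neg_add_cancel])
  simp only [← h.add_apply, add_neg_cancel_left, map_neg, map_smul] at h2
  exact h2

theorem graph_apply (h : IsUnitaryGroupOf A U) {ψ φ : E} (hψ : (ψ, φ) ∈ A.graph) (t : ℝ) :
    (U t ψ, U t φ) ∈ A.graph := by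
  rw [h.generator]
  have h1 := ((h.generator ψ φ).1 hψ).continuousLinearMap_apply (U t)
  simp only [← h.add_apply, map_neg, map_smul, add_comm t] at h1
  simp only [← h.add_apply]
  exact h1

theorem inner_generator (h : IsUnitaryGroupOf A U) {ψ φ : E} (hψ : (ψ, φ) ∈ A.graph) :
    inner ℂ ψ (-(Complex.I • φ)) + inner ℂ (-(Complex.I • φ)) ψ = 0 := by
  have h1 := (h.generator ψ φ).1 hψ
  have h2 := h1.inner ℂ h1
  simp only [h.inner_apply, h.zero_apply] at h2
  exact h2.unique (hasDerivAt_const _ _)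

/-- A densely defined operator generates at most one unitary group. -/
theorem unique {W : ℝ → E →L[ℂ] E} (hU : IsUnitaryGroupOf A U) (hW : IsUnitaryGroupOf A W)
    (hA : Dense (A.domain : Set E)) : U = W := by
  funext t
  refine ContinuousLinearMap.ext_on (s := (A.domain : Set E)) (by rwa [Submodule.span_eq]) ?_
  intro ψ hψ
  obtain ⟨φ, hφ⟩ := LinearPMap.mem_domain_iff.1 hψ
  -- The difference of the two orbits stays in the domain and solves the same equation, so its norm
  -- keeps its initial value zero.
  have hy : ∀ t, HasDerivAt (fun t => U t ψ - W t ψ) (-(Complex.I • (U t φ - W t φ))) t := by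
    intro t
    rw [smul_sub, neg_sub']
    exact (hU.hasDerivAt hφ t).sub (hW.hasDerivAt hφ t)
  have hn := norm_eq_of_hasDerivAt hy (fun t => hU.inner_generator
    (A.graph.sub_mem (hU.graph_apply hφ t) (hW.graph_apply hφ t))) t
  rw [hU.zero_apply, hW.zero_apply, sub_self, norm_zero, norm_eq_zero, sub_eq_zero] at hn
  exact hn

/-- If `A` generates a unitary group, so does `A + J` with `J` bounded and self-adjoint. -/
theorem exists_of_bounded_perturbation {B : E →ₗ.[ℂ] E} {J : E →L[ℂ] E}
    (h : IsUnitaryGroupOf A U) (hJ : ∀ ψ φ, inner ℂ (J ψ) φ = inner ℂ ψ (J φ))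
    (hB : ∀ ψ φ, (ψ, φ) ∈ B.graph ↔ (ψ, φ - J ψ) ∈ A.graph) :
    ∃ W, IsUnitaryGroupOf B W := by
  -- Interaction picture: with `y' = K(t) y`, the perturbed orbit is `U t (y t)`. The unbounded
  -- generator has disappeared from this equation.
  set K : ℝ → E →L[ℂ] E := fun t => -(Complex.I • (U (-t) * J * U t)) with hKdef
  have hKa : ∀ t ψ, K t ψ = -(Complex.I • U (-t) (J (U t ψ))) := fun _ _ => rfl
  have hC : ∀ t, ‖K t‖ ≤ ‖J‖ := fun t =>
    (K t).opNorm_le_bound (norm_nonneg _) fun ψ => by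
      rw [hKa, norm_neg, norm_smul, Complex.norm_I, one_mul, h.norm_apply, ← h.norm_apply t ψ]
      exact J.le_opNorm _
  have hK : ∀ ψ, Continuous fun t => K t ψ := fun ψ => by
    have h1 : Continuous fun t => U (-t) (J (U t ψ)) :=
      continuous_apply_of_norm_le (K := fun t => U (-t)) (fun t => h.norm_le_one (-t))
        (fun φ => (h.continuous φ).comp continuous_neg) (J.continuous.comp (h.continuous ψ))
    exact (h1.const_smul Complex.I).neg
  choose y hy0 hy using exists_hasDerivAt_apply hC hK
  have hyn : ∀ ψ t, ‖y ψ t‖ = ‖ψ‖ := fun ψ t => by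
    rw [norm_eq_of_hasDerivAt (hy ψ) (fun t => ?_) t, hy0]
    rw [hKa, inner_neg_left, inner_neg_right, inner_smul_left, inner_smul_right, h.inner_neg_apply,
      hJ, ← h.inner_neg_apply (-t), neg_neg, Complex.conj_I]
    ring
  have hadd : ∀ ψ φ t, y (ψ + φ) t = y ψ t + y φ t := fun ψ φ t =>
    congrFun (eq_of_hasDerivAt_apply hC (hy (ψ + φ)) (w := fun t => y ψ t + y φ t)
      (fun t => by rw [map_add]; exact (hy ψ t).add (hy φ t)) (by simp only [hy0])) t
  have hsmul : ∀ (c : ℂ) ψ t, y (c • ψ) t = c • y ψ t := fun c ψ t =>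
    congrFun (eq_of_hasDerivAt_apply hC (hy (c • ψ)) (w := fun t => c • y ψ t)
      (fun t => by rw [map_smul]; exact (hy ψ t).const_smul c) (by simp only [hy0])) t
  let W : ℝ → E →L[ℂ] E := fun t =>
    LinearMap.mkContinuous
      { toFun := fun ψ => U t (y ψ t)
        map_add' := fun ψ φ => by rw [hadd, map_add]
        map_smul' := fun c ψ => by rw [hsmul, map_smul]; rfl } 1
      fun ψ => le_of_eq (by
        rw [one_mul]; exact (h.norm_apply t _).trans (hyn ψ t))
  have hWa : ∀ t ψ, W t ψ = U t (y ψ t) := fun _ _ => rfl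
  have hWn : ∀ t ψ, ‖W t ψ‖ = ‖ψ‖ := fun t ψ => by rw [hWa, h.norm_apply, hyn]
  have hW0 : W 0 = 1 := by
    ext ψ
    rw [hWa, h.zero_apply, hy0]; rfl
  have hWadd : ∀ s t, W (s + t) = W t * W s := fun s t => by
    ext ψ
    -- Since `U s * K (s + t) = K t * U s`, the translated solution solves the same equation with
    -- initial value `W s ψ`.
    have h1 : (fun t => U s (y ψ (s + t))) = y (W s ψ) := by
      refine eq_of_hasDerivAt_apply hC (fun t => ?_) (hy _) (by simp only [hy0, add_zero, hWa])
      have h2 := (HasDerivAt.comp_const_add s t (hy ψ (s + t))).continuousLinearMap_apply (U s)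
      convert h2 using 1
      rw [hKa, hKa, map_neg, map_smul, ← h.add_apply, ← h.add_apply, add_comm t s]
      congr 4
      ring
    have h3 := congrFun h1 t
    calc W (s + t) ψ = U t (U s (y ψ (s + t))) := by rw [hWa, add_comm, h.add_apply]
      _ = W t (W s ψ) := by rw [hWa t]; exact congrArg _ h3
  refine ⟨W, ⟨fun t => mem_unitary_of_norm_map (v := W (-t)) (hWn t) ?_, hW0, fun s t => ?_,
    fun ψ => ?_, fun ψ φ => ?_⟩⟩
  · rw [← hWadd, neg_add_cancel, hW0]
  · rw [add_comm, hWadd]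
  · exact continuous_apply_of_norm_le h.norm_le_one h.continuous
      (continuous_iff_continuousAt.2 fun t => (hy ψ t).continuousAt)
  -- This is `W t ψ - U t ψ`. It is differentiable at `0` for every `ψ`, in the domain or not, so
  -- the two orbits are differentiable at `0` for the same vectors; this identifies the domains
  -- exactly.
  · have hd : HasDerivAt (fun t => U t (y ψ t - ψ)) (-(Complex.I • J ψ)) 0 := by
      have h1 := hasDerivAt_iff_tendsto_slope_zero.1 (hy ψ 0)
      rw [hasDerivAt_iff_tendsto_slope_zero]
      have h2 := ((h.continuous (K 0 (y ψ 0))).tendsto 0).mono_left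
        (nhdsWithin_le_nhds (s := {0}ᶜ))
      have h3 := tendsto_apply_of_norm_le h.norm_le_one h1 h2
      rw [h.zero_apply, hKa, neg_zero, h.zero_apply, h.zero_apply, hy0] at h3
      refine h3.congr fun t => ?_
      rw [zero_add, hy0, sub_self, map_zero, sub_zero]
      exact ((U t).restrictScalars ℝ).map_smul t⁻¹ _
    rw [hB, h.generator]
    constructor
    · intro h1
      convert h1.add hd using 1
      · funext t; simp [hWa]
      · rw [smul_sub]; abel
    · intro h1
      convert h1.sub hd using 1
      · funext t; simp [hWa]
      · rw [smul_sub]; abel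

end IsUnitaryGroupOf

end HierModel

/-! ### Multiplication operators on `ℓ²` -/

namespace HierModel

section SequenceSpace

variable {ι : Type}

theorem memℓp_two_iff {f : ι → ℂ} : Memℓp f 2 ↔ Summable fun i => ‖f i‖ ^ 2 := by
  rw [memℓp_gen_iff (by norm_num)]
  simp

theorem summable_norm_sq (f : ell2 ι) : Summable fun i => ‖f i‖ ^ 2 := memℓp_two_iff.1 f.2

theorem ell2_norm_sq (f : ell2 ι) : ‖f‖ ^ 2 = ∑' i, ‖f i‖ ^ 2 := by
  have := lp.norm_rpow_eq_tsum (p := 2) (by norm_num) f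
  simpa using this

/-- Dominated convergence in `ℓ²`. -/
theorem tendsto_ell2_of_dominated {α : Type*} {l : Filter α} {F : α → ell2 ι} {G : ell2 ι}
    {b : ι → ℝ} (hb : Summable fun i => b i ^ 2) (hF : ∀ i, Tendsto (fun a => F a i) l (𝓝 (G i)))
    (hbd : ∀ a i, ‖F a i - G i‖ ≤ b i) : Tendsto F l (𝓝 G) := by
  rw [tendsto_iff_norm_sub_tendsto_zero]
  have h1 : Tendsto (fun a => ∑' i, ‖F a i - G i‖ ^ 2) l (𝓝 (∑' _ : ι, (0 : ℝ))) := by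
    refine tendsto_tsum_of_dominated_convergence hb (fun i => ?_) (Eventually.of_forall fun a i => ?_)
    · have := (tendsto_iff_norm_sub_tendsto_zero.1 (hF i)).pow 2
      simpa using this
    · rw [Real.norm_eq_abs, abs_of_nonneg (by positivity)]
      gcongr
      exact hbd a i
  have h2 : ∀ a, ‖F a - G‖ = √(∑' i, ‖F a i - G i‖ ^ 2) := fun a => by
    rw [← Real.sqrt_sq (norm_nonneg (F a - G)), ell2_norm_sq]
    rfl
  simp only [h2]
  simpa using h1.sqrt

theorem mem_graph_maximalOperator {L : (ι → ℂ) →ₗ[ℂ] (ι → ℂ)} {ψ φ : ell2 ι} :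
    (ψ, φ) ∈ (maximalOperator L).graph ↔ L ψ = φ := by
  rw [LinearPMap.mem_graph_iff]
  constructor
  · rintro ⟨y, rfl, hy⟩
    exact congrArg (fun f : ell2 ι => (f : ι → ℂ)) hy
  · intro h
    refine ⟨⟨ψ, ?_⟩, rfl, lp.ext h⟩
    change Memℓp (L ψ) 2
    rw [h]
    exact φ.2

/-- Multiplication by the function `V`. -/
def mulExpr (V : ι → ℝ) : (ι → ℂ) →ₗ[ℂ] (ι → ℂ) where
  toFun ψ n := (V n : ℂ) * ψ n
  map_add' a b := by
    ext n
    simp only [Pi.add_apply]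
    ring
  map_smul' c a := by
    ext n
    simp only [Pi.smul_apply, smul_eq_mul, RingHom.id_apply]
    ring

theorem norm_exp_neg_I_mul (x : ℝ) : ‖Complex.exp (-(Complex.I * x))‖ = 1 := by
  rw [← mul_neg, mul_comm, ← Complex.ofReal_neg, Complex.norm_exp_ofReal_mul_I]

/-- The unitary group `exp(-itV)` of multiplication operators. -/
noncomputable def mulGroup (V : ι → ℝ) (t : ℝ) : ell2 ι →L[ℂ] ell2 ι :=
  LinearMap.mkContinuous
    { toFun := fun ψ => ⟨fun i => Complex.exp (-(Complex.I * ((t * V i : ℝ) : ℂ))) * ψ i,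
        memℓp_two_iff.2 (by simpa only [norm_mul, norm_exp_neg_I_mul, one_mul]
          using summable_norm_sq ψ)⟩
      map_add' := fun a b => by
        apply lp.ext
        funext i
        exact mul_add _ _ _
      map_smul' := fun c a => by
        apply lp.ext
        funext i
        exact mul_left_comm _ _ _ } 1
    fun ψ => by
      rw [one_mul, ← sq_le_sq₀ (norm_nonneg _) (norm_nonneg _), ell2_norm_sq, ell2_norm_sq]
      refine le_of_eq (tsum_congr fun i => ?_)
      change ‖Complex.exp (-(Complex.I * ((t * V i : ℝ) : ℂ))) * ψ i‖ ^ 2 = _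
      rw [norm_mul, norm_exp_neg_I_mul, one_mul]

theorem mulGroup_apply (V : ι → ℝ) (t : ℝ) (ψ : ell2 ι) (i : ι) :
    mulGroup V t ψ i = Complex.exp (-(Complex.I * ((t * V i : ℝ) : ℂ))) * ψ i := rfl

theorem hasDerivAt_mulGroup_apply (V : ι → ℝ) (ψ : ell2 ι) (i : ι) (t : ℝ) :
    HasDerivAt (fun t => mulGroup V t ψ i)
      (mulGroup V t ψ i * (-(Complex.I * (V i : ℂ)))) t := by
  have h1 : HasDerivAt (fun t : ℝ => -(Complex.I * ((t * V i : ℝ) : ℂ)))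
      (-(Complex.I * (V i : ℂ))) t := by
    have h2 := (((hasDerivAt_id t).mul_const (V i)).ofReal_comp.const_mul Complex.I).neg
    simp only [one_mul] at h2
    exact h2
  have h3 := h1.cexp.mul_const (ψ i)
  simp only [mulGroup_apply]
  exact h3.congr_deriv (by ring)

/-- On the maximal domain, `|e^{-itV} - 1| ≤ |t| |V|` dominates the difference quotients by `|Vψ| ∈
ℓ²`. Conversely, a derivative in `ℓ²` can be read off coordinatewise, which forces `Vψ = φ ∈ ℓ²`. -/
theorem isUnitaryGroupOf_mulGroup (V : ι → ℝ) :
    IsUnitaryGroupOf (maximalOperator (mulExpr V)) (mulGroup V) := by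
  have hn : ∀ t ψ i, ‖mulGroup V t ψ i‖ = ‖ψ i‖ := fun t ψ i => by
    rw [mulGroup_apply, norm_mul, norm_exp_neg_I_mul, one_mul]
  have hzero : mulGroup V 0 = 1 := by
    ext ψ i
    simp [mulGroup_apply]
  have hadd : ∀ s t, mulGroup V (s + t) = mulGroup V s * mulGroup V t := fun s t => by
    ext ψ i
    change mulGroup V (s + t) ψ i = mulGroup V s (mulGroup V t ψ) i
    simp only [mulGroup_apply, ← mul_assoc, ← Complex.exp_add]
    congr 2
    push_cast
    ring
  refine ⟨fun t => mem_unitary_of_norm_map (v := mulGroup V (-t)) (fun ψ => ?_) ?_, hzero, hadd,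
    fun ψ => ?_, fun ψ φ => ?_⟩
  · rw [← sq_eq_sq₀ (norm_nonneg _) (norm_nonneg _), ell2_norm_sq, ell2_norm_sq]
    simp only [hn]
  · rw [← hadd, add_neg_cancel, hzero]
  · refine continuous_iff_continuousAt.2 fun t => ?_
    refine tendsto_ell2_of_dominated (b := fun i => 2 * ‖ψ i‖) ?_
      (fun i => (hasDerivAt_mulGroup_apply V ψ i t).continuousAt) fun s i => ?_
    · simpa only [mul_pow] using (summable_norm_sq ψ).mul_left (2 ^ 2)
    · refine (norm_sub_le _ _).trans (le_of_eq ?_)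
      rw [hn, hn]
      ring
  · rw [mem_graph_maximalOperator]
    constructor
    · intro h
      have hφ : ∀ i, φ i = (V i : ℂ) * ψ i := fun i => (congrFun h i).symm
      rw [hasDerivAt_zero_iff_tendsto_slope]
      refine tendsto_ell2_of_dominated (b := fun i => 2 * ‖φ i‖) ?_ (fun i => ?_) fun t i => ?_
      · simpa only [mul_pow] using (summable_norm_sq φ).mul_left (2 ^ 2)
      · have h1 := hasDerivAt_iff_tendsto_slope_zero.1 (hasDerivAt_mulGroup_apply V ψ i 0)
        have h2 : (-(Complex.I • φ) : ell2 ι) i =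
            mulGroup V 0 ψ i * (-(Complex.I * (V i : ℂ))) := by
          change -(Complex.I * φ i) = _
          rw [hzero, hφ]
          change _ = ψ i * _
          ring
        rw [h2]
        refine h1.congr fun t => ?_
        rw [zero_add, ← Complex.coe_smul]
        rfl
      · have h1 : ‖(mulGroup V t ψ - ψ) i‖ ≤ |t| * ‖φ i‖ := by
          have h2 : (mulGroup V t ψ - ψ) i =
              (Complex.exp (Complex.I * ((-(t * V i) : ℝ) : ℂ)) - 1) * ψ i := by
            rw [lp.coeFn_sub, Pi.sub_apply, mulGroup_apply, Complex.ofReal_neg, mul_neg]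
            ring
          rw [h2, norm_mul, hφ, norm_mul, ← mul_assoc]
          gcongr
          refine Real.norm_exp_I_mul_ofReal_sub_one_le.trans (le_of_eq ?_)
          rw [norm_neg, norm_mul, Complex.norm_real, Real.norm_eq_abs]
        have h3 : ‖(((t⁻¹ : ℝ) : ℂ) • (mulGroup V t ψ - mulGroup V 0 ψ)) i‖ ≤ ‖φ i‖ := by
          rw [hzero]
          change ‖((t⁻¹ : ℝ) : ℂ) • (mulGroup V t ψ - ψ) i‖ ≤ _
          rw [norm_smul, Complex.norm_real, norm_inv, Real.norm_eq_abs]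
          -- Domination is required for every `t`; at `t = 0` the quotient is zero because `0⁻¹ =
          -- 0`.
          rcases eq_or_ne t 0 with rfl | ht
          · simp
          · rw [inv_mul_le_iff₀ (abs_pos.2 ht)]
            exact h1
        refine (norm_sub_le _ _).trans ?_
        have h4 : ‖(-(Complex.I • φ) : ell2 ι) i‖ = ‖φ i‖ := by
          change ‖-(Complex.I * φ i)‖ = _
          simp
        linarith
    · intro h
      funext i
      have h1 := (lp.evalCLM ℂ (fun _ : ι => ℂ) 2 i).restrictScalars ℝ |>.hasFDerivAt.comp_hasDerivAt (0 : ℝ) h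
      have h2 := h1.unique (hasDerivAt_mulGroup_apply V ψ i 0)
      rw [hzero] at h2
      change -(Complex.I * φ i) = ψ i * _ at h2
      change (V i : ℂ) * ψ i = φ i
      linear_combination (-Complex.I) * h2 - (φ i - V i * ψ i) * Complex.I_sq

end SequenceSpace

end HierModel

/-! ### Laplace transforms and the resolvent equation -/

namespace HierModel

theorem integrableOn_exp_neg_mul_smul {F : Type*} [NormedAddCommGroup F] [NormedSpace ℝ F]
    {ε : ℝ} (hε : 0 < ε) {x : ℝ → F} (hx : Continuous x) {C : ℝ} (hC : ∀ t, ‖x t‖ ≤ C) :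
    IntegrableOn (fun t => Real.exp (-ε * t) • x t) (Set.Ioi 0) := by
  refine Integrable.mono' ((exp_neg_integrableOn_Ioi 0 hε).mul_const C) ?_ ?_
  · exact (Continuous.aestronglyMeasurable (by fun_prop))
  · refine Eventually.of_forall fun t => ?_
    rw [norm_smul, Real.norm_eq_abs, Real.abs_exp]
    exact mul_le_mul_of_nonneg_left (hC t) (Real.exp_pos _).le

theorem integral_exp_neg_mul {ε : ℝ} (hε : 0 < ε) :
    ∫ t in Set.Ioi (0 : ℝ), Real.exp (-ε * t) = ε⁻¹ := by
  rw [integral_exp_mul_Ioi (neg_lt_zero.2 hε)]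
  simp

/-- A weighted Cauchy–Schwarz inequality for Laplace transforms. -/
theorem mul_norm_integral_exp_sq_le {ε : ℝ} (hε : 0 < ε) {x : ℝ → ℂ} (hx : Continuous x) {C : ℝ}
    (hC : ∀ t, ‖x t‖ ≤ C) :
    ε * ‖∫ t in Set.Ioi (0 : ℝ), Real.exp (-ε * t) • x t‖ ^ 2 ≤
      ∫ t in Set.Ioi (0 : ℝ), Real.exp (-ε * t) * ‖x t‖ ^ 2 := by
  set w := ∫ t in Set.Ioi (0 : ℝ), Real.exp (-ε * t) • x t with hw
  -- This is the optimal constant when `2c‖x‖ ≤ ‖x‖² + c²` is integrated against `e^{-εt}`.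
  set c := ε * ‖w‖ with hc
  have hc0 : 0 ≤ c := by positivity
  have hi1 : IntegrableOn (fun t => Real.exp (-ε * t) * ‖x t‖) (Set.Ioi 0) :=
    integrableOn_exp_neg_mul_smul hε hx.norm (C := C) fun t => by simpa using hC t
  have hi2 : IntegrableOn (fun t => Real.exp (-ε * t) * ‖x t‖ ^ 2) (Set.Ioi 0) :=
    integrableOn_exp_neg_mul_smul hε (hx.norm.pow 2) (C := C ^ 2) fun t => by
      rw [norm_pow, norm_norm]
      exact pow_le_pow_left₀ (norm_nonneg _) (hC t) 2
  have hi0 := exp_neg_integrableOn_Ioi 0 hε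
  have h1 : ‖w‖ ≤ ∫ t in Set.Ioi (0 : ℝ), Real.exp (-ε * t) * ‖x t‖ := by
    refine (norm_integral_le_integral_norm _).trans (le_of_eq ?_)
    refine integral_congr_ae (Eventually.of_forall fun t => ?_)
    change ‖Real.exp (-ε * t) • x t‖ = _
    rw [norm_smul, Real.norm_eq_abs, Real.abs_exp]
  have h2 : 2 * c * ∫ t in Set.Ioi (0 : ℝ), Real.exp (-ε * t) * ‖x t‖ ≤
      (∫ t in Set.Ioi (0 : ℝ), Real.exp (-ε * t) * ‖x t‖ ^ 2) + c ^ 2 * ε⁻¹ := by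
    rw [← integral_exp_neg_mul hε, ← integral_const_mul, ← integral_const_mul,
      ← integral_add hi2 (hi0.const_mul _)]
    refine integral_mono (hi1.const_mul _) (hi2.add (hi0.const_mul _)) fun t => ?_
    have := mul_nonneg (Real.exp_pos (-ε * t)).le (sq_nonneg (‖x t‖ - c))
    change 2 * c * (_ * _) ≤ _ * _ + c ^ 2 * _
    nlinarith
  have h3 := mul_le_mul_of_nonneg_left h1 (mul_nonneg zero_le_two hc0)
  have h4 : c ^ 2 * ε⁻¹ = ε * ‖w‖ ^ 2 := by
    rw [hc]; field_simp
  have h5 : 2 * c * ‖w‖ = 2 * (ε * ‖w‖ ^ 2) := by rw [hc]; ring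
  linarith

/-- The Laplace transform of an orbit. -/
noncomputable def laplace {E : Type} [NormedAddCommGroup E] [InnerProductSpace ℂ E]
    (U : ℝ → E →L[ℂ] E) (ε : ℝ) (ψ : E) : E :=
  ∫ t in Set.Ioi (0 : ℝ), Real.exp (-ε * t) • U t ψ

namespace IsUnitaryGroupOf

variable {E : Type} [NormedAddCommGroup E] [InnerProductSpace ℂ E] [CompleteSpace E]
  {A : E →ₗ.[ℂ] E} {U : ℝ → E →L[ℂ] E}

theorem integrableOn_exp_smul (h : IsUnitaryGroupOf A U) {ε : ℝ} (hε : 0 < ε) (ψ : E) :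
    IntegrableOn (fun t => Real.exp (-ε * t) • U t ψ) (Set.Ioi 0) :=
  integrableOn_exp_neg_mul_smul hε (h.continuous ψ) fun t => (h.norm_apply t ψ).le

theorem map_laplace (h : IsUnitaryGroupOf A U) {ε : ℝ} (hε : 0 < ε) (ψ : E) (f : E →L[ℂ] ℂ) :
    f (laplace U ε ψ) = ∫ t in Set.Ioi (0 : ℝ), Real.exp (-ε * t) • f (U t ψ) := by
  rw [laplace, ← f.integral_comp_comm (h.integrableOn_exp_smul hε ψ)]
  refine integral_congr_ae (Eventually.of_forall fun t => ?_)
  simp only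
  rw [← Complex.coe_smul, ← Complex.coe_smul, map_smul]

/-- Integrate the derivative of `e^{-εt} U t ψ` over `(0, ∞)`; the boundary term at infinity
vanishes. -/
theorem laplace_generator (h : IsUnitaryGroupOf A U) {ε : ℝ} (hε : 0 < ε) {ψ φ : E}
    (hψ : (ψ, φ) ∈ A.graph) :
    (ε : ℂ) • laplace U ε ψ + Complex.I • laplace U ε φ = ψ := by
  have hiψ := h.integrableOn_exp_smul hε ψ
  have hiφ := h.integrableOn_exp_smul hε φ
  have hd : ∀ t, HasDerivAt (fun t => Real.exp (-ε * t) • U t ψ)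
      (-((ε : ℂ) • (Real.exp (-ε * t) • U t ψ) + Complex.I • (Real.exp (-ε * t) • U t φ))) t := by
    intro t
    have h1 : HasDerivAt (fun t => Real.exp (-ε * t)) (Real.exp (-ε * t) * (-ε)) t := by
      simpa using ((hasDerivAt_id t).const_mul (-ε)).exp
    refine (h1.smul (h.hasDerivAt hψ t)).congr_deriv ?_
    rw [Complex.coe_smul, smul_neg, smul_smul ε, mul_neg, neg_smul, mul_comm ε,
      smul_comm (Real.exp (-ε * t)) Complex.I, neg_add, add_comm]
  have hlim : Tendsto (fun t => Real.exp (-ε * t) • U t ψ) atTop (𝓝 0) := by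
    refine squeeze_zero_norm (a := fun t => Real.exp (-ε * t) * ‖ψ‖) (fun t => ?_) ?_
    · rw [norm_smul, Real.norm_eq_abs, Real.abs_exp, h.norm_apply]
    · have h1 : Tendsto (fun t : ℝ => Real.exp (-ε * t)) atTop (𝓝 0) :=
        Real.tendsto_exp_atBot.comp (tendsto_id.const_mul_atTop_of_neg (neg_lt_zero.2 hε))
      simpa using h1.mul_const ‖ψ‖
  have h2 := integral_Ioi_of_hasDerivAt_of_tendsto' (a := 0) (fun t _ => hd t)
    ((hiψ.smul (ε : ℂ)).add (hiφ.smul Complex.I)).neg hlim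
  have h3 : ∫ t in Set.Ioi (0 : ℝ),
      ((ε : ℂ) • (Real.exp (-ε * t) • U t ψ) + Complex.I • (Real.exp (-ε * t) • U t φ)) =
      (ε : ℂ) • laplace U ε ψ + Complex.I • laplace U ε φ := by
    rw [laplace, laplace, ← integral_smul, ← integral_smul]
    exact integral_add (hiψ.smul (ε : ℂ)) (hiφ.smul Complex.I)
  rw [integral_neg, h3, mul_zero, Real.exp_zero, one_smul, zero_sub, neg_inj, h.zero_apply] at h2
  exact h2

end IsUnitaryGroupOf

/-! ### Bounded self-adjoint operator plus real potential -/

section DiscreteSchrodinger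

variable {ι : Type} {L : (ι → ℂ) →ₗ[ℂ] (ι → ℂ)} {J : ell2 ι →L[ℂ] ell2 ι} {V : ι → ℝ}

/-- The maximal operator of the sum of a bounded self-adjoint operator and a real potential
generates a unitary group. -/
theorem exists_isUnitaryGroupOf (hJ : ∀ ψ φ, inner ℂ (J ψ) φ = inner ℂ ψ (J φ))
    (hL : ∀ (ψ : ell2 ι) i, L ψ i = J ψ i + V i * ψ i) :
    ∃ U, IsUnitaryGroupOf (maximalOperator L) U := by
  refine (isUnitaryGroupOf_mulGroup V).exists_of_bounded_perturbation hJ fun ψ φ => ?_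
  rw [mem_graph_maximalOperator, mem_graph_maximalOperator, funext_iff, funext_iff]
  refine forall_congr' fun i => ?_
  rw [hL, lp.coeFn_sub, Pi.sub_apply, eq_sub_iff_add_eq, add_comm]
  rfl

variable [DecidableEq ι]

theorem delta_apply (m i : ι) : delta m i = if i = m then 1 else 0 := by
  rw [delta, lp.single_apply]
  exact Pi.single_apply m (1 : ℂ) i

theorem inner_delta (m : ι) (ψ : ell2 ι) : inner ℂ (delta m) ψ = ψ m := by
  rw [delta, lp.inner_single_left]
  simp

theorem delta_mem_graph (hL : ∀ (ψ : ell2 ι) i, L ψ i = J ψ i + V i * ψ i) (m : ι) :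
    (delta m, J (delta m) + (V m : ℂ) • delta m) ∈ (maximalOperator L).graph := by
  rw [mem_graph_maximalOperator]
  funext i
  rw [hL]
  change _ = J (delta m) i + (V m : ℂ) * delta m i
  rw [delta_apply]
  split_ifs with h
  · rw [h]
  · simp

theorem dense_domain (hL : ∀ (ψ : ell2 ι) i, L ψ i = J ψ i + V i * ψ i) :
    Dense ((maximalOperator L).domain : Set (ell2 ι)) := by
  intro f
  refine mem_closure_of_tendsto (lp.hasSum_single ENNReal.ofNat_ne_top f)
    (Eventually.of_forall fun s => ?_)
  refine Submodule.sum_mem _ fun i _ => ?_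
  have h1 : lp.single (E := fun _ : ι => ℂ) 2 i (f i) = f i • delta i := by
    rw [delta, ← lp.single_smul, smul_eq_mul, mul_one]
  rw [h1]
  exact Submodule.smul_mem _ _ (LinearPMap.mem_domain_iff.2 ⟨_, delta_mem_graph hL i⟩)

theorem existsUnique_isUnitaryGroupOf (hJ : ∀ ψ φ, inner ℂ (J ψ) φ = inner ℂ ψ (J φ))
    (hL : ∀ (ψ : ell2 ι) i, L ψ i = J ψ i + V i * ψ i) :
    ∃! U, IsUnitaryGroupOf (maximalOperator L) U := by
  obtain ⟨U, hU⟩ := exists_isUnitaryGroupOf hJ hL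
  exact ⟨U, hU, fun W hW => hW.unique hU (dense_domain hL)⟩

/-- The Laplace transform of the evolution of `δ_m` solves the resolvent equation at the spectral
parameter `iε`, and it bounds the time-averaged probabilities from below. -/
theorem exists_resolvent_le_avgProb (hJ : ∀ ψ φ, inner ℂ (J ψ) φ = inner ℂ ψ (J φ))
    (hL : ∀ (ψ : ell2 ι) i, L ψ i = J ψ i + V i * ψ i) (m : ι) {T : ℝ} (hT : 0 < T) :
    ∃ w : ell2 ι,
      (∀ i, L w i = Complex.I * ((2 / T : ℝ) : ℂ) * w i - Complex.I * delta m i) ∧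
      ∀ i, ENNReal.ofReal (2 / T ^ 2 * ‖w i‖ ^ 2) ≤
        avgProb (maximalOperator L) (delta m) i T := by
  set U := evolution (maximalOperator L) with hUdef
  have hU : IsUnitaryGroupOf (maximalOperator L) U :=
    Classical.epsilon_spec (exists_isUnitaryGroupOf hJ hL)
  set ε := 2 / T with hεdef
  have hε : 0 < ε := by positivity
  have hδ := delta_mem_graph hL m
  set φ := J (delta m) + (V m : ℂ) • delta m with hφ
  let ev : ι → ell2 ι →L[ℂ] ℂ := fun i => innerSL ℂ (delta i)
  have hev : ∀ i ψ, ev i ψ = ψ i := fun i ψ => inner_delta i ψ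
  set w := laplace U ε (delta m) with hw
  have hLw : ∀ i, laplace U ε φ i = L w i := by
    intro i
    -- Although the operator is unbounded, each coordinate of `L ψ` is a bounded functional of `ψ`
    -- and hence commutes with the integral.
    let g : ell2 ι →L[ℂ] ℂ := (ev i).comp J + (V i : ℂ) • ev i
    have hg : ∀ ψ : ell2 ι, g ψ = L ψ i := fun ψ => by
      rw [hL, ← hev i (J ψ), ← hev i ψ]
      rfl
    have hUφ : ∀ t, ev i (U t φ) = g (U t (delta m)) := fun t => by
      rw [hg, hev, mem_graph_maximalOperator.1 (hU.graph_apply hδ t)]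
    rw [← hg, ← hev, hw, hU.map_laplace hε, hU.map_laplace hε]
    simp only [hUφ]
  refine ⟨w, fun i => ?_, fun i => ?_⟩
  · have h1 := congrArg (ev i) (hU.laplace_generator hε hδ)
    rw [map_add, map_smul, map_smul, hev, hev, hev, hLw, smul_eq_mul, smul_eq_mul] at h1
    linear_combination (-Complex.I) * h1 + L w i * Complex.I_sq
  · have hxi : ∀ t, ‖U t (delta m) i‖ ≤ ‖delta m‖ := fun t =>
      (lp.norm_apply_le_norm two_ne_zero _ i).trans (hU.norm_apply t _).le
    have hxic : Continuous fun t => U t (delta m) i := by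
      simp only [← hev]
      exact (ev i).continuous.comp (hU.continuous _)
    have hwi : w i = ∫ t in Set.Ioi (0 : ℝ), Real.exp (-ε * t) • U t (delta m) i := by
      rw [← hev, hw, hU.map_laplace hε]
      simp only [hev]
    have hint : IntegrableOn (fun t => Real.exp (-ε * t) * ‖U t (delta m) i‖ ^ 2) (Set.Ioi 0) :=
      integrableOn_exp_neg_mul_smul hε (hxic.norm.pow 2) (C := ‖delta m‖ ^ 2) fun t => by
        rw [norm_pow, norm_norm]
        exact pow_le_pow_left₀ (norm_nonneg _) (hxi t) 2
    have hexp : ∀ t, -2 * t / T = -ε * t := fun t => by rw [hεdef]; ring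
    rw [avgProb]
    simp only [inner_delta, hexp]
    rw [← ofReal_integral_eq_lintegral_ofReal hint
      (Eventually.of_forall fun t => by positivity), ← ENNReal.ofReal_mul (by positivity)]
    refine ENNReal.ofReal_le_ofReal ?_
    have h1 := mul_norm_integral_exp_sq_le hε hxic hxi
    rw [← hwi] at h1
    calc 2 / T ^ 2 * ‖w i‖ ^ 2 = 1 / T * (ε * ‖w i‖ ^ 2) := by rw [hεdef]; field_simp
      _ ≤ _ := mul_le_mul_of_nonneg_left h1 (by positivity)

end DiscreteSchrodinger

/-! ### Hopping operators on the line and the half-line -/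

section Shift

variable {ι : Type}

/-- Composition with an injective map, as a bounded operator on `ℓ²`. -/
noncomputable def compInjective (s : ι → ι) (hs : s.Injective) : ell2 ι →L[ℂ] ell2 ι :=
  LinearMap.mkContinuous
    { toFun := fun ψ => ⟨fun i => ψ (s i),
        memℓp_two_iff.2 ((summable_norm_sq ψ).comp_injective hs)⟩
      map_add' := fun _ _ => rfl
      map_smul' := fun _ _ => rfl } 1
    fun ψ => by
      rw [one_mul, ← sq_le_sq₀ (norm_nonneg _) (norm_nonneg _), ell2_norm_sq, ell2_norm_sq]
      exact tsum_comp_le_tsum_of_inj (summable_norm_sq ψ) (fun _ => by positivity) hs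

theorem compInjective_apply (s : ι → ι) (hs : s.Injective) (ψ : ell2 ι) (i : ι) :
    compInjective s hs ψ i = ψ (s i) := rfl

/-- The hopping operator `(Jψ)(n) = ψ(s n) + ∑_{s m = n} ψ(m)`. -/
noncomputable def hopping (s : ι → ι) (hs : s.Injective) : ell2 ι →L[ℂ] ell2 ι :=
  compInjective s hs + ContinuousLinearMap.adjoint (compInjective s hs)

theorem inner_hopping (s : ι → ι) (hs : s.Injective) (ψ φ : ell2 ι) :
    inner ℂ (hopping s hs ψ) φ = inner ℂ ψ (hopping s hs φ) := by
  simp only [hopping, _root_.add_apply, inner_add_left, inner_add_right,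
    ContinuousLinearMap.adjoint_inner_left, ContinuousLinearMap.adjoint_inner_right]
  ring

variable [DecidableEq ι]

theorem hopping_apply_map (s : ι → ι) (hs : s.Injective) (ψ : ell2 ι) (m : ι) :
    hopping s hs ψ (s m) = ψ (s (s m)) + ψ m := by
  have h1 : compInjective s hs (delta (s m)) = delta m := by
    apply lp.ext
    funext i
    rw [compInjective_apply, delta_apply, delta_apply]
    simp only [hs.eq_iff]
  change ψ (s (s m)) + ContinuousLinearMap.adjoint (compInjective s hs) ψ (s m) = _
  rw [← inner_delta (s m), ContinuousLinearMap.adjoint_inner_right, h1, inner_delta]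

/-- The source of the Dirichlet condition: the shift on `ℕ+` misses the site `1`, where the adjoint
therefore contributes nothing. -/
theorem hopping_apply_of_notMem (s : ι → ι) (hs : s.Injective) (ψ : ell2 ι) {n : ι}
    (hn : ∀ m, s m ≠ n) : hopping s hs ψ n = ψ (s n) := by
  have h1 : compInjective s hs (delta n) = 0 := by
    apply lp.ext
    funext i
    rw [compInjective_apply, delta_apply, if_neg (hn i)]
    rfl
  change ψ (s n) + ContinuousLinearMap.adjoint (compInjective s hs) ψ n = _
  rw [← inner_delta n (ContinuousLinearMap.adjoint (compInjective s hs) ψ),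
    ContinuousLinearMap.adjoint_inner_right, h1, inner_zero_left, add_zero]

end Shift

theorem lineExpr_apply_eq (V : ℤ → ℝ) (ψ : ell2 ℤ) (n : ℤ) :
    lineExpr V ψ n = hopping (· + 1) (add_left_injective 1) ψ n + V n * ψ n := by
  have := hopping_apply_map (· + 1) (add_left_injective (1 : ℤ)) ψ (n - 1)
  simp only [sub_add_cancel] at this
  rw [this]
  change ψ (n - 1) + ψ (n + 1) + _ = _
  ring

theorem halfLineExpr_apply_eq (V : ℕ+ → ℝ) (ψ : ell2 ℕ+) (n : ℕ+) :
    halfLineExpr V ψ n = hopping (· + 1) (add_left_injective 1) ψ n + V n * ψ n := by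
  change (if n = 1 then 0 else ψ (n - 1)) + ψ (n + 1) + _ = _
  rcases eq_or_ne n 1 with rfl | hn
  · rw [hopping_apply_of_notMem _ _ _ fun m h => m.ne_zero (by simpa using congrArg PNat.val h)]
    simp
  · obtain ⟨m, rfl⟩ := PNat.exists_eq_succ_of_ne_one hn
    rw [hopping_apply_map (· + 1) (add_left_injective (1 : ℕ+)) ψ m, if_neg hn,
      PNat.add_sub]
    ring

end HierModel

/-! ### From solution bounds to growth exponents -/

namespace HierModel

/-- A power-law lower bound for the growth exponent from lower bounds on the time-averaged
probabilities at the scales `2 ^ l`. -/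
theorem le_lowerExponent {ι : Type} [DecidableEq ι] {pos : ι → ℝ} {A : ell2 ι →ₗ.[ℂ] ell2 ι}
    {ψ : ell2 ι} {p c K q β : ℝ} (hp : 0 < p) (hc : 0 < c) (hK : 0 < K) (hq : 1 < q)
    (h : ∀ T : ℝ, 0 < T → ∀ l : ℕ, K * q ^ l ≤ T →
      ∃ n, 2 ^ l ≤ |pos n| ∧ ENNReal.ofReal (c / T ^ 2) ≤ avgProb A ψ n T)
    (hβ : β < p / Real.logb 2 q - 2) : (β : EReal) ≤ lowerExponent pos A ψ p := by
  have hq0 : 0 < q := zero_lt_one.trans hq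
  have hlog : 0 < Real.logb 2 q := Real.logb_pos one_lt_two hq
  set γ := p / Real.logb 2 q with hγ
  have hγ0 : 0 < γ := by positivity
  have hqγ : q ^ γ = 2 ^ p := by
    have h1 : q = 2 ^ Real.logb 2 q := (Real.rpow_logb two_pos (by norm_num) hq0).symm
    calc q ^ γ = (2 ^ Real.logb 2 q) ^ γ := by rw [← h1]
      _ = 2 ^ p := by
        rw [← Real.rpow_mul zero_le_two, hγ, mul_div_cancel₀ _ hlog.ne']
  set c' := c / (K * q) ^ γ with hc'
  have hc'0 : 0 < c' := by positivity
  have hmoment : ∀ T, K ≤ T → ENNReal.ofReal (c' * T ^ γ / T ^ 2) ≤ moment pos A ψ p T := by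
    intro T hT
    have hT0 : 0 < T := hK.trans_le hT
    -- The scale is fixed by `q^l ≤ T/K < q^(l+1)`; then `q^γ = 2^p` turns `(2^l)^p` into a multiple
    -- of `T^γ`.
    obtain ⟨l, hl1, hl2⟩ := exists_nat_pow_near ((one_le_div hK).2 hT) hq
    obtain ⟨n, hn1, hn2⟩ := h T hT0 l (by rwa [le_div_iff₀' hK] at hl1)
    have h1 : (T / (K * q)) ^ γ ≤ |pos n| ^ p := by
      calc (T / (K * q)) ^ γ ≤ (q ^ l) ^ γ := by
            refine Real.rpow_le_rpow (by positivity) ?_ hγ0.le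
            rw [← div_div, div_le_iff₀ hq0, ← pow_succ]
            exact hl2.le
        _ = (2 ^ l) ^ p := by
            rw [← Real.rpow_natCast q, ← Real.rpow_natCast 2, ← Real.rpow_mul hq0.le,
              ← Real.rpow_mul zero_le_two, mul_comm, mul_comm (l : ℝ) p, Real.rpow_mul hq0.le,
              Real.rpow_mul zero_le_two, hqγ]
        _ ≤ |pos n| ^ p := Real.rpow_le_rpow (by positivity) hn1 hp.le
    calc ENNReal.ofReal (c' * T ^ γ / T ^ 2)
        = ENNReal.ofReal ((T / (K * q)) ^ γ) * ENNReal.ofReal (c / T ^ 2) := by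
          rw [← ENNReal.ofReal_mul (by positivity), Real.div_rpow hT0.le (by positivity), hc']
          congr 1
          ring
      _ ≤ ENNReal.ofReal (|pos n| ^ p) * avgProb A ψ n T :=
          mul_le_mul' (ENNReal.ofReal_le_ofReal h1) hn2
      _ ≤ moment pos A ψ p T :=
          ENNReal.le_tsum (f := fun n => ENNReal.ofReal (|pos n| ^ p) * avgProb A ψ n T) n
  -- The strict gap between `β` and `γ - 2` absorbs the constant `c'`.
  have hlarge : ∀ᶠ T : ℝ in atTop, -Real.log c' ≤ (γ - 2 - β) * Real.log T :=
    (Real.tendsto_log_atTop.const_mul_atTop (by linarith)).eventually_ge_atTop _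
  refine le_liminf_of_le (by isBoundedDefault) ?_
  filter_upwards [hlarge, eventually_ge_atTop K, eventually_gt_atTop 1] with T h1 h2 h3
  have hT0 : 0 < T := zero_lt_one.trans h3
  have hlogT : 0 < Real.log T := Real.log_pos h3
  have hpos : 0 < c' * T ^ γ / T ^ 2 := by positivity
  have h4 : β * Real.log T ≤ Real.log (c' * T ^ γ / T ^ 2) := by
    rw [Real.log_div (by positivity) (by positivity), Real.log_mul hc'0.ne' (by positivity),
      Real.log_rpow hT0, Real.log_pow]
    push_cast
    linarith
  rw [EReal.le_div_iff_mul_le (by exact_mod_cast hlogT) (EReal.coe_ne_top _), ← EReal.coe_mul]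
  calc ((β * Real.log T : ℝ) : EReal) ≤ (Real.log (c' * T ^ γ / T ^ 2) : EReal) := by
        exact_mod_cast h4
    _ = ENNReal.log (ENNReal.ofReal (c' * T ^ γ / T ^ 2)) :=
        (ENNReal.log_ofReal_of_pos hpos).symm
    _ ≤ _ := ENNReal.log_monotone (hmoment T h2)

theorem one_le_hierAlpha (R : ℝ) : 1 ≤ hierAlpha R := le_max_left _ _

/-- A growth rate `r` slightly above `2 ^ α` suffices for the exponent bound. -/
theorem exists_rate (R p : ℝ) (hR : 0 < R) :
    ∃ r : ℝ, 2 < r ∧ R ≤ r ∧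
      (p - 1 - 4 * hierAlpha R) / (1 + hierAlpha R) < p / Real.logb 2 (2 * r) - 2 := by
  set α := hierAlpha R with hα
  have hα1 : 1 ≤ α := one_le_hierAlpha R
  have hcont : ContinuousAt (fun a : ℝ => p / (1 + a) - 2) α := by
    have : 1 + α ≠ 0 := by linarith
    fun_prop (disch := assumption)
  have hlt : (p - 1 - 4 * α) / (1 + α) < p / (1 + α) - 2 := by
    rw [div_sub' (by linarith), div_lt_div_iff_of_pos_right (by linarith)]
    linarith
  -- Approaching `α` from the right keeps `2^a > 2` and `2^a ≥ R`.
  have hev := (hcont.eventually (eventually_gt_nhds hlt)).filter_mono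
    (nhdsWithin_le_nhds (s := Set.Ioi α))
  obtain ⟨a, ha1, ha2⟩ := (hev.and self_mem_nhdsWithin).exists
  have ha2 : α < a := ha2
  refine ⟨2 ^ a, ?_, ?_, ?_⟩
  · calc (2 : ℝ) = 2 ^ (1 : ℝ) := (Real.rpow_one 2).symm
      _ < 2 ^ a := Real.rpow_lt_rpow_of_exponent_lt one_lt_two (by linarith)
  · rw [← Real.logb_le_iff_le_rpow one_lt_two hR]
    exact (le_max_right _ _).trans ha2.le
  · have : Real.logb 2 (2 * 2 ^ a) = 1 + a := by
      rw [Real.logb_mul two_ne_zero (by positivity), Real.logb_self_eq_one one_lt_two,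
        Real.logb_rpow two_pos (by norm_num)]
    rw [this]
    exact ha1

/-- Solutions of the resolvent equation bound the growth exponent from below. -/
theorem le_lowerExponent_of_recurrence {ι : Type} [DecidableEq ι] {L : (ι → ℂ) →ₗ[ℂ] (ι → ℂ)}
    {J : ell2 ι →L[ℂ] ell2 ι} {V : ι → ℝ} {pos : ι → ℝ} {m : ι} {lam R p : ℝ} (hR : 0 < R)
    (hp : 0 < p) (hJ : ∀ ψ φ, inner ℂ (J ψ) φ = inner ℂ ψ (J φ))
    (hL : ∀ (ψ : ell2 ι) i, L ψ i = J ψ i + V i * ψ i)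
    (hrec : ∀ (z : ℂ) (w : ell2 ι), (∀ i, L w i = z * w i - Complex.I * delta m i) →
      ∃ u : ℕ → ℂ, 1 / 2 ≤ ‖u 0‖ ∧
        (∀ n, u (n + 2) + u n +
          ((lam * hierF R (padicValNat 2 (n + 1)) : ℝ) : ℂ) * u (n + 1) = z * u (n + 1)) ∧
        ∀ n : ℕ, n ≠ 0 → ∃ i, |pos i| = n ∧ w i = u n) :
    (((p - 1 - 4 * hierAlpha R) / (1 + hierAlpha R) : ℝ) : EReal) ≤
      lowerExponent pos (maximalOperator L) (delta m) p := by
  obtain ⟨r, hr, hRr, hβ⟩ := exists_rate R p hR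
  have hr2 : 0 < r - 2 := by linarith
  -- Here `16 = 8 · 2` because `‖z‖ = 2/T`. Below, `1/128 = 2 · (1/16)²`, where `1/16` is the lower
  -- bound `1/2` for `‖u 0‖` divided by `8`.
  have hK : 0 < 16 * (1 + |lam| * (r / (r - 2))) := by positivity
  refine le_lowerExponent (c := 1 / 128) hp (by norm_num) hK (by linarith) ?_ hβ
  intro T hT l hl
  obtain ⟨w, hw, hprob⟩ := exists_resolvent_le_avgProb hJ hL m hT
  obtain ⟨u, hu0, hu, hwu⟩ := hrec _ w hw
  have hz : ‖Complex.I * ((2 / T : ℝ) : ℂ)‖ = 2 / T := by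
    rw [norm_mul, Complex.norm_I, one_mul, Complex.norm_real, Real.norm_eq_abs,
      abs_of_pos (by positivity)]
  obtain ⟨n, hn, hun⟩ := exists_norm_ge_of_recurrence hR hr hRr hu (l := l) (by
    rw [hz]
    calc _ = 16 * (1 + |lam| * (r / (r - 2))) * (2 * r) ^ l / T := by ring
      _ ≤ 1 := (div_le_one hT).2 hl)
  -- The site must be nonzero, since `u 0` need not be a value of `w`.
  obtain ⟨i, hi, hwi⟩ := hwu n (Nat.pos_of_ne_zero (by positivity) |>.trans_le hn).ne'
  refine ⟨i, ?_, (ENNReal.ofReal_le_ofReal ?_).trans (hprob i)⟩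
  · rw [hi]
    exact_mod_cast hn
  · have h1 : 1 / 16 ≤ ‖w i‖ := by rw [hwi]; linarith
    calc 1 / 128 / T ^ 2 = 2 / T ^ 2 * (1 / 16) ^ 2 := by ring
      _ ≤ _ := by gcongr

/-! ### Absorbing the source into the boundary value -/

/-- If `|w(0)| ≥ 1/2`, the left half-line works: it never meets the source, and `ord₂` is even.
Otherwise the source at site `1` is moved into `u(0) = w(0) + i`, of modulus at least `1/2`. The
recurrence is never centred at `0`, so `V(0)` plays no role. -/
theorem line_recurrence (lam R v₀ : ℝ) (z : ℂ) (w : ℤ → ℂ)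
    (hw : ∀ i, lineExpr (linePotential lam R v₀) w i = z * w i - Complex.I * delta 1 i) :
    ∃ u : ℕ → ℂ, 1 / 2 ≤ ‖u 0‖ ∧
      (∀ n, u (n + 2) + u n +
        ((lam * hierF R (padicValNat 2 (n + 1)) : ℝ) : ℂ) * u (n + 1) = z * u (n + 1)) ∧
      ∀ n : ℕ, n ≠ 0 → ∃ i : ℤ, |(i : ℝ)| = n ∧ w i = u n := by
  have hV : ∀ k : ℤ, k ≠ 0 →
      linePotential lam R v₀ k = lam * hierF R (padicValNat 2 k.natAbs) := fun k hk => if_neg hk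
  have heq : ∀ k : ℤ, w (k - 1) + w (k + 1) + (linePotential lam R v₀ k : ℂ) * w k =
      z * w k - Complex.I * (if k = 1 then 1 else 0) := fun k => by
    rw [← delta_apply]; exact hw k
  by_cases h0 : 1 / 2 ≤ ‖w 0‖
  · refine ⟨fun n => w (-(n : ℤ)), by simpa using h0, fun n => ?_,
      fun n _ => ⟨-(n : ℤ), by simp, rfl⟩⟩
    have h1 := heq (-((n + 1 : ℕ) : ℤ))
    rw [hV _ (by omega), Int.natAbs_neg, Int.natAbs_natCast, if_neg (by omega),
      show -((n + 1 : ℕ) : ℤ) - 1 = -((n + 2 : ℕ) : ℤ) by push_cast; ring,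
      show -((n + 1 : ℕ) : ℤ) + 1 = -(n : ℤ) by push_cast; ring] at h1
    linear_combination h1
  · refine ⟨fun n => if n = 0 then w 0 + Complex.I else w n, ?_, fun n => ?_,
      fun n hn => ⟨n, by simp, by simp [hn]⟩⟩
    · change 1 / 2 ≤ ‖w 0 + Complex.I‖
      have h1 : ‖Complex.I‖ ≤ ‖w 0 + Complex.I‖ + ‖w 0‖ := by
        have := norm_sub_le (w 0 + Complex.I) (w 0)
        rwa [add_sub_cancel_left] at this
      rw [Complex.norm_I] at h1
      linarith
    · have h1 := heq ((n + 1 : ℕ) : ℤ)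
      rw [hV _ (by omega), Int.natAbs_natCast,
        show ((n + 1 : ℕ) : ℤ) - 1 = (n : ℤ) by push_cast; ring,
        show ((n + 1 : ℕ) : ℤ) + 1 = ((n + 2 : ℕ) : ℤ) by push_cast; ring] at h1
      beta_reduce
      rw [if_neg (Nat.succ_ne_zero (n + 1)), if_neg (Nat.succ_ne_zero n)]
      rcases eq_or_ne n 0 with rfl | hn
      · rw [if_pos rfl]
        rw [if_pos (by norm_num)] at h1
        push_cast at h1 ⊢
        linear_combination h1
      · rw [if_neg (by omega)] at h1
        rw [if_neg hn]
        linear_combination h1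

theorem halfLine_recurrence (lam R : ℝ) (z : ℂ) (w : ℕ+ → ℂ)
    (hw : ∀ i, halfLineExpr (halfLinePotential lam R) w i = z * w i - Complex.I * delta 1 i) :
    ∃ u : ℕ → ℂ, 1 / 2 ≤ ‖u 0‖ ∧
      (∀ n, u (n + 2) + u n +
        ((lam * hierF R (padicValNat 2 (n + 1)) : ℝ) : ℂ) * u (n + 1) = z * u (n + 1)) ∧
      ∀ n : ℕ, n ≠ 0 → ∃ i : ℕ+, |((i : ℕ) : ℝ)| = n ∧ w i = u n := by
  have heq : ∀ k : ℕ, (if k = 0 then 0 else w (Nat.toPNat' k)) + w (Nat.succPNat (k + 1)) +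
      ((lam * hierF R (padicValNat 2 (k + 1)) : ℝ) : ℂ) * w (Nat.succPNat k) =
      z * w (Nat.succPNat k) - Complex.I * (if k = 0 then 1 else 0) := fun k => by
    have h1 := hw (Nat.succPNat k)
    have h2 : Nat.succPNat k = 1 ↔ k = 0 := by
      rw [← PNat.coe_inj]; simp
    rw [delta_apply] at h1
    change (if Nat.succPNat k = 1 then 0 else w (Nat.succPNat k - 1)) + w (Nat.succPNat k + 1) +
      ((lam * hierF R (padicValNat 2 (k + 1)) : ℝ) : ℂ) * w (Nat.succPNat k) = _ at h1
    simp only [h2] at h1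
    rw [← h1]
    congr 2
  -- With `ψ(0) = 0` the whole boundary value is the source, `u(0) = i`. The test `n = 0` also
  -- shields the default `Nat.toPNat' 0 = 1`.
  refine ⟨fun n => if n = 0 then Complex.I else w (Nat.toPNat' n), ?_, fun n => ?_,
    fun n hn => ⟨Nat.toPNat' n, ?_, by simp [hn]⟩⟩
  · simp only [if_true, Complex.norm_I]
    norm_num
  · have h1 := heq n
    have h2 : ∀ k, Nat.toPNat' (k + 1) = Nat.succPNat k := fun k => rfl
    beta_reduce
    rw [if_neg (Nat.succ_ne_zero (n + 1)), if_neg (Nat.succ_ne_zero n), h2, h2]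
    rcases eq_or_ne n 0 with rfl | hn
    · simp only [if_true] at h1 ⊢
      linear_combination h1
    · rw [if_neg hn, if_neg hn] at h1
      rw [if_neg hn]
      linear_combination h1
  · rw [Nat.abs_cast, Nat.toPNat'_coe, if_pos (Nat.pos_of_ne_zero hn)]

end HierModel

theorem theorem5p2 (lam R : ℝ) (hlam : lam ≠ 0) (hR : 0 < R) :
    (∀ v₀ : ℝ,
      (∃! U : ℝ → HierModel.ell2 ℤ →L[ℂ] HierModel.ell2 ℤ, HierModel.IsUnitaryGroupOf
        (HierModel.lineOperator (HierModel.linePotential lam R v₀)) U) ∧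
      ∀ p : ℝ, 0 < p →
        (((p - 1 - 4 * HierModel.hierAlpha R) / (1 + HierModel.hierAlpha R) : ℝ) : EReal) ≤
          HierModel.lowerExponent (fun n : ℤ => (n : ℝ))
            (HierModel.lineOperator (HierModel.linePotential lam R v₀)) (HierModel.delta 1) p) ∧
    ((∃! U : ℝ → HierModel.ell2 ℕ+ →L[ℂ] HierModel.ell2 ℕ+, HierModel.IsUnitaryGroupOf
        (HierModel.halfLineOperator (HierModel.halfLinePotential lam R)) U) ∧
      ∀ p : ℝ, 0 < p →
        (((p - 1 - 4 * HierModel.hierAlpha R) / (1 + HierModel.hierAlpha R) : ℝ) : EReal) ≤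
          HierModel.lowerExponent (fun n : ℕ+ => ((n : ℕ) : ℝ))
            (HierModel.halfLineOperator (HierModel.halfLinePotential lam R))
            (HierModel.delta 1) p) := by
  have hJℤ := HierModel.inner_hopping (· + 1) (add_left_injective (1 : ℤ))
  have hJℕ := HierModel.inner_hopping (· + 1) (add_left_injective (1 : ℕ+))
  refine ⟨fun v₀ => ⟨?_, fun p hp => ?_⟩, ?_, fun p hp => ?_⟩
  · exact HierModel.existsUnique_isUnitaryGroupOf hJℤ (HierModel.lineExpr_apply_eq _)
  · exact HierModel.le_lowerExponent_of_recurrence hR hp hJℤ (HierModel.lineExpr_apply_eq _)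
      fun z w => HierModel.line_recurrence lam R v₀ z w
  · exact HierModel.existsUnique_isUnitaryGroupOf hJℕ (HierModel.halfLineExpr_apply_eq _)
  · exact HierModel.le_lowerExponent_of_recurrence hR hp hJℕ (HierModel.halfLineExpr_apply_eq _)
      fun z w => HierModel.halfLine_recurrence lam R z w
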